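/- Let $P$ be a convex $n$-gon in the plane ($n\ge 3$, vertices in strictly convex position) with vertex set $V$. For a non-empty $V'\subseteq V$, the convex hull of $V'$ is called a subpolygon of $P$ (it may be a segment or a point), and it is proper if it differs from $P$, that is, if $V'\neq V$. For a subpolygon $R$ of $P$, a subpolygon $Q$ of $R$ and a vertex $v$ of $R$, put $\varphi(v,Q)=0$ if $v$ is a vertex of $Q$, and otherwise $\varphi(v,Q)=\pi-\angle svt$, where $s$ and $t$ are the two consecutive vertices of $Q$ such that $v$ lies between $s$ and $t$ in counter-clockwise order (with $s=t$ if $Q$ is a single point). The aperture-angle error of $R$ with respect to $Q$ is \[ \varphi(R,Q)=\max_{v}\varphi(v,Q), \] where $v$ runs over the vertices of $R$, and \[ \varphi_k(R)=\min_{Q}\varphi(R,Q), \] where $Q$ runs over the subpolygons of $R$ with at most $k$ vertices. Call $P$ worst-approximable (for $k$) if $\varphi_k(R)<\varphi_k(P)$ for every proper subpolygon $R$ of $P$. Lemma. Let $k>2$ be an integer, and let $P$ be a convex $n$-gon that is worst-approximable with respect to the aperture-angle error. Then $n=k+1$. -/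

import Mathlib

/-- Twice the signed area of the triangle `a b c`; it is positive if and only if `a`, `b`, `c` form
a left turn. -/
noncomputable def signedArea (a b c : EuclideanSpace ℝ (Fin 2)) : ℝ :=
  (b 0 - a 0) * (c 1 - a 1) - (b 1 - a 1) * (c 0 - a 0)

/-- A convex `n`-gon in the plane, given by its `n ≥ 3` vertices in counter-clockwise order.
The last condition says that the points are in strictly convex position (no point lies in the
convex hull of the others) and that they are listed counter-clockwise. -/
structure ConvexNGon (n : ℕ) where
  vertex : Fin n → EuclideanSpace ℝ (Fin 2)
  three_le : 3 ≤ n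
  ccw : ∀ i j l : Fin n, i < j → j < l → 0 < signedArea (vertex i) (vertex j) (vertex l)

namespace ConvexNGon

variable {n : ℕ}

/-- The number of steps of a counter-clockwise traversal from vertex `i` to vertex `j`
(subtraction in `Fin n` is modulo `n`). -/
def steps (i j : Fin n) : ℕ := ((j - i : Fin n) : ℕ)

/-- The first vertex of `Q` that a counter-clockwise traversal starting at `v` encounters. -/
noncomputable def next (Q : Finset (Fin n)) (hQ : Q.Nonempty) (v : Fin n) : Fin n :=
  (Q.exists_min_image (fun q => steps v q) hQ).choose

/-- The last vertex of `Q` before `v` in counter-clockwise order, that is, the first one that a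
clockwise traversal starting at `v` encounters. -/
noncomputable def prev (Q : Finset (Fin n)) (hQ : Q.Nonempty) (v : Fin n) : Fin n :=
  (Q.exists_min_image (fun q => steps q v) hQ).choose

theorem next_spec (Q : Finset (Fin n)) (hQ : Q.Nonempty) (v : Fin n) :
    next Q hQ v ∈ Q ∧ ∀ q ∈ Q, steps v (next Q hQ v) ≤ steps v q :=
  (Q.exists_min_image (fun q => steps v q) hQ).choose_spec

theorem prev_spec (Q : Finset (Fin n)) (hQ : Q.Nonempty) (v : Fin n) :
    prev Q hQ v ∈ Q ∧ ∀ q ∈ Q, steps (prev Q hQ v) v ≤ steps q v :=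
  (Q.exists_min_image (fun q => steps q v) hQ).choose_spec

/-- `ψ(v, s, t) = π - ∠ s v t`. -/
noncomputable def psi (P : ConvexNGon n) (v s t : Fin n) : ℝ :=
  Real.pi - EuclideanGeometry.angle (P.vertex s) (P.vertex v) (P.vertex t)

/-- The error `φ(v, Q)` of the vertex `v` with respect to the subpolygon with vertex set `Q`:
it is zero if `v` is a vertex of `Q`, and otherwise `ψ(v, s, t)` where `s` and `t` are the two
consecutive vertices of `Q` with `v` between them (`s = t` if `Q` is a single point). -/
noncomputable def vertexError (P : ConvexNGon n) (Q : Finset (Fin n)) (hQ : Q.Nonempty)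
    (v : Fin n) : ℝ :=
  if v ∈ Q then 0 else P.psi v (prev Q hQ v) (next Q hQ v)

/-- The aperture-angle error `φ(R, Q)`, the maximum of `φ(v, Q)` over the vertices `v` of `R`.
Subpolygons of `P` (convex hulls of non-empty sets of vertices of `P`) are given by their vertex
sets; a subpolygon inherits its counter-clockwise order from `P`. -/
noncomputable def error (P : ConvexNGon n) (R : Finset (Fin n)) (hR : R.Nonempty)
    (Q : Finset (Fin n)) (hQ : Q.Nonempty) : ℝ :=
  R.sup' hR (P.vertexError Q hQ)

/-- The errors `φ(R, Q)` of all subpolygons `Q` of `R` with at most `k` vertices. -/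
def errorSet (P : ConvexNGon n) (k : ℕ) (R : Finset (Fin n)) : Set ℝ :=
  {e | ∃ (Q : Finset (Fin n)) (hQ : Q.Nonempty) (hQR : Q ⊆ R),
    Q.card ≤ k ∧ P.error R (hQ.mono hQR) Q hQ = e}

/-- `φ_k(R)`, the smallest error `φ(R, Q)` of a subpolygon `Q` of `R` with at most `k` vertices.
The infimum is over a finite set, so that it is a minimum. -/
noncomputable def optimalError (P : ConvexNGon n) (k : ℕ) (R : Finset (Fin n)) : ℝ :=
  sInf (P.errorSet k R)

theorem isLeast_optimalError (P : ConvexNGon n) {k : ℕ} (hk : 0 < k) {R : Finset (Fin n)}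
    (hR : R.Nonempty) : IsLeast (P.errorSet k R) (P.optimalError k R) := by
  have hfin : (P.errorSet k R).Finite := by
    refine (Set.finite_range
      (fun Q : {Q : Finset (Fin n) // Q.Nonempty ∧ Q ⊆ R} =>
        P.error R (Q.2.1.mono Q.2.2) Q.1 Q.2.1)).subset ?_
    rintro e ⟨Q, hQ, hQR, -, rfl⟩
    exact ⟨⟨Q, hQ, hQR⟩, rfl⟩
  have hne : (P.errorSet k R).Nonempty := by
    obtain ⟨v, hv⟩ := hR
    exact ⟨_, {v}, Finset.singleton_nonempty v, Finset.singleton_subset_iff.2 hv,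
      by rw [Finset.card_singleton]; exact hk, rfl⟩
  exact ⟨hne.csInf_mem hfin, fun e he => csInf_le hfin.bddBelow he⟩

/-- `P` is worst-approximable (for `k` and the aperture-angle error): `φ_k(R) < φ_k(P)` for every
proper subpolygon `R` of `P`. -/
def WorstApproximable (P : ConvexNGon n) (k : ℕ) : Prop :=
  ∀ R : Finset (Fin n), R.Nonempty → R ≠ Finset.univ →
    P.optimalError k R < P.optimalError k Finset.univ

end ConvexNGon

/-! Let E = φ_k(P). If k ≥ n, then Q = P gives E = 0, and no error is smaller; so k < n. Suppose n >
k + 1. Enlarging a gap of Q increases the errors inside it (`psi_mono`), so a vertex missed by Q has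
error at least its exterior angle. Hence at most k vertices have exterior angle ≥ E: k + 1 of them
would span a proper subpolygon, and every Q with at most k vertices misses one. So some exterior
angle is < E, and it suffices to find a vertex u such that every Q with errors < E at all other
vertices also has error < E at u (`exists_removable`): deleting u then leaves φ_k at least E, a
contradiction.

Take a maximal chain of vertices with exterior angle < E, together with the vertices bounding it.
Some circle through three consecutive vertices of it encloses the whole chain (`exists_ear_circle`);
let u be the middle one. Since Q contains all vertices with large exterior angle, the ends s, t of
the gap of Q around u lie inside this circle. If the gap contains only u, the error of u is its
exterior angle. Otherwise a neighbour of u in the gap lies on or outside the circle through s, u, t,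
so it sees s and t under no larger angle and has at least the error of u (`exists_psi_le`). -/

namespace ConvexNGon

/-! ### Angles and circles in coordinates -/

/-- The inner product of `s - v` and `t - v`. -/
noncomputable def dotAt (v s t : EuclideanSpace ℝ (Fin 2)) : ℝ :=
  (s 0 - v 0) * (t 0 - v 0) + (s 1 - v 1) * (t 1 - v 1)

/-- The quotient is the cotangent of the angle at `v`. As arctan is monotone, comparing angles
becomes a polynomial inequality. -/
theorem pi_sub_angle_eq {s v t : EuclideanSpace ℝ (Fin 2)} (h : 0 < signedArea s v t) :
    Real.pi - EuclideanGeometry.angle s v t =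
      Real.pi / 2 + Real.arctan (dotAt v s t / signedArea s v t) := by
  set d := dotAt v s t with hd
  set A := signedArea s v t with hA
  have hinner : inner ℝ (s -ᵥ v) (t -ᵥ v) = d := by
    simp [hd, dotAt, PiLp.inner_apply, Fin.sum_univ_two]
    ring
  have hnorm : ‖s -ᵥ v‖ * ‖t -ᵥ v‖ = √(d ^ 2 + A ^ 2) := by
    rw [EuclideanSpace.norm_eq, EuclideanSpace.norm_eq, ← Real.sqrt_mul (by positivity)]
    congr 1
    simp [hd, hA, dotAt, signedArea, Fin.sum_univ_two]
    ring
  have hsqrt : √(d ^ 2 + A ^ 2) = A * √(1 + (d / A) ^ 2) := by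
    have : d ^ 2 + A ^ 2 = A ^ 2 * (1 + (d / A) ^ 2) := by field_simp; ring
    rw [this, Real.sqrt_mul (by positivity), Real.sqrt_sq h.le]
  have hangle : EuclideanGeometry.angle s v t = Real.pi / 2 - Real.arctan (d / A) := by
    unfold EuclideanGeometry.angle InnerProductGeometry.angle
    rw [hinner, hnorm, hsqrt, Real.arccos, ← Real.arcsin_sin' (x := Real.arctan (d / A)),
      Real.sin_arctan]
    · congr 2
      rw [← div_div]
    · exact ⟨(Real.neg_pi_div_two_lt_arctan _).le, (Real.arctan_lt_pi_div_two _).le⟩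
  rw [hangle]
  ring

theorem pi_sub_angle_le {s v t s' v' t' : EuclideanSpace ℝ (Fin 2)}
    (h : 0 < signedArea s v t) (h' : 0 < signedArea s' v' t')
    (hle : dotAt v s t * signedArea s' v' t' ≤ dotAt v' s' t' * signedArea s v t) :
    Real.pi - EuclideanGeometry.angle s v t ≤ Real.pi - EuclideanGeometry.angle s' v' t' := by
  rw [pi_sub_angle_eq h, pi_sub_angle_eq h']
  have := Real.arctan_mono ((div_le_div_iff₀ h h').2 hle)
  linarith

theorem pi_sub_angle_mono_left {a s v t : EuclideanSpace ℝ (Fin 2)}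
    (hat : 0 < signedArea a v t) (hst : 0 < signedArea s v t) (hsa : 0 ≤ signedArea s a v) :
    Real.pi - EuclideanGeometry.angle a v t ≤ Real.pi - EuclideanGeometry.angle s v t := by
  refine pi_sub_angle_le hat hst ?_
  have key : dotAt v s t * signedArea a v t - dotAt v a t * signedArea s v t =
      signedArea s a v * ((t 0 - v 0) ^ 2 + (t 1 - v 1) ^ 2) := by
    simp only [dotAt, signedArea]; ring
  have : 0 ≤ signedArea s a v * ((t 0 - v 0) ^ 2 + (t 1 - v 1) ^ 2) := by positivity
  linarith

theorem pi_sub_angle_mono_right {b s v t : EuclideanSpace ℝ (Fin 2)}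
    (hsb : 0 < signedArea s v b) (hst : 0 < signedArea s v t) (hbt : 0 ≤ signedArea v b t) :
    Real.pi - EuclideanGeometry.angle s v b ≤ Real.pi - EuclideanGeometry.angle s v t := by
  refine pi_sub_angle_le hsb hst ?_
  have key : dotAt v s t * signedArea s v b - dotAt v s b * signedArea s v t =
      signedArea v b t * ((s 0 - v 0) ^ 2 + (s 1 - v 1) ^ 2) := by
    simp only [dotAt, signedArea]; ring
  have : 0 ≤ signedArea v b t * ((s 0 - v 0) ^ 2 + (s 1 - v 1) ^ 2) := by positivity
  linarith

/-- The power of `x` with respect to the circle with equation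
`x₀ ^ 2 + x₁ ^ 2 + α * x₀ + β * x₁ + γ = 0`. -/
noncomputable def circlePower (α β γ : ℝ) (x : EuclideanSpace ℝ (Fin 2)) : ℝ :=
  x 0 ^ 2 + x 1 ^ 2 + α * x 0 + β * x 1 + γ

/-- Adding a multiple of the equation of the line `y z` moves a circle through `y` and `z` within
the pencil of all such circles. -/
theorem exists_circlePower_add_mul_signedArea (α β γ τ : ℝ) (y z : EuclideanSpace ℝ (Fin 2)) :
    ∃ α' β' γ' : ℝ, ∀ x,
      circlePower α' β' γ' x = circlePower α β γ x + τ * signedArea y x z :=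
  ⟨α + τ * (z 1 - y 1), β - τ * (z 0 - y 0),
    γ + τ * (y 1 * (z 0 - y 0) - y 0 * (z 1 - y 1)), fun x => by
      simp only [circlePower, signedArea]; ring⟩

/-- Thales: this is the circle with diameter `y z`. -/
theorem exists_circlePower_eq_dotAt (y z : EuclideanSpace ℝ (Fin 2)) :
    ∃ α β γ : ℝ, ∀ x, circlePower α β γ x = dotAt x y z :=
  ⟨-(y 0 + z 0), -(y 1 + z 1), y 0 * z 0 + y 1 * z 1, fun x => by
    simp only [circlePower, dotAt]; ring⟩

/-- The difference of two circle powers is affine. -/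
theorem signedArea_mul_circlePower_sub {α β γ α' β' γ' : ℝ} {a u b : EuclideanSpace ℝ (Fin 2)}
    (hga : circlePower α β γ a = 0) (hgu : circlePower α β γ u = 0)
    (hgb : circlePower α β γ b = 0) (hhu : circlePower α' β' γ' u = 0)
    (x : EuclideanSpace ℝ (Fin 2)) :
    signedArea a u b * circlePower α' β' γ' x = signedArea a u b * circlePower α β γ x +
      signedArea x u b * circlePower α' β' γ' a + signedArea a u x * circlePower α' β' γ' b := by
  have e : signedArea a u b * (circlePower α' β' γ' x - circlePower α β γ x) =
      signedArea x u b * (circlePower α' β' γ' a - circlePower α β γ a) +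
      signedArea a u x * (circlePower α' β' γ' b - circlePower α β γ b) +
      (signedArea a u b - signedArea x u b - signedArea a u x) *
        (circlePower α' β' γ' u - circlePower α β γ u) := by
    simp only [circlePower, signedArea]; ring
  rw [hga, hgb, hgu, hhu] at e
  linarith

/-- If the circle through `s`, `u`, `t` does not contain `w`, then `w` sees `s` and `t` under a
smaller angle than `u` does. -/
theorem exists_circlePower_pencil {s u t : EuclideanSpace ℝ (Fin 2)} (hu : 0 < signedArea s u t) :
    ∃ α β γ : ℝ, circlePower α β γ s = 0 ∧ circlePower α β γ u = 0 ∧ circlePower α β γ t = 0 ∧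
      ∀ w, 0 < signedArea s w t → 0 ≤ circlePower α β γ w →
        Real.pi - EuclideanGeometry.angle s u t ≤ Real.pi - EuclideanGeometry.angle s w t := by
  obtain ⟨α₀, β₀, γ₀, h₀⟩ := exists_circlePower_eq_dotAt s t
  -- The coefficient is minus the cotangent of the angle at `u`, so that the Thales circle is moved
  -- to pass through `u`. The power of `w` is then its signed area times the difference of the
  -- cotangents at `w` and `u`.
  obtain ⟨α, β, γ, h⟩ := exists_circlePower_add_mul_signedArea α₀ β₀ γ₀
    (-(dotAt u s t / signedArea s u t)) s t
  refine ⟨α, β, γ, ?_, ?_, ?_, fun w hw hpw => pi_sub_angle_le hu hw ?_⟩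
  · rw [h, h₀]; simp only [dotAt, signedArea]; ring
  · rw [h, h₀]; field_simp; ring
  · rw [h, h₀]; simp only [dotAt, signedArea]; ring
  · rw [h, h₀] at hpw
    have := mul_nonneg hpw hu.le
    have e : (dotAt w s t + -(dotAt u s t / signedArea s u t) * signedArea s w t) *
        signedArea s u t = dotAt w s t * signedArea s u t - dotAt u s t * signedArea s w t := by
      field_simp
      ring
    linarith

theorem signedArea_rotate (a b c : EuclideanSpace ℝ (Fin 2)) :
    signedArea b c a = signedArea a b c := by
  simp only [signedArea]; ring

theorem signedArea_self_left (a b : EuclideanSpace ℝ (Fin 2)) : signedArea a a b = 0 := by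
  simp only [signedArea]; ring

theorem signedArea_self_right (a b : EuclideanSpace ℝ (Fin 2)) : signedArea a b b = 0 := by
  simp only [signedArea]; ring

/-! ### A circle through three consecutive vertices that encloses a convex chain -/

/-- In the pencil of circles through the ends of a convex chain there is one that encloses the
chain and passes through an interior vertex. -/
theorem exists_pencil_apex {p : ℕ → EuclideanSpace ℝ (Fin 2)} {a b : ℕ} (hab : a + 2 ≤ b)
    (H : ∀ j, a < j → j < b → 0 < signedArea (p a) (p j) (p b)) (α β γ : ℝ) :
    ∃ τ : ℝ, ∃ j, a < j ∧ j < b ∧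
      circlePower α β γ (p j) + τ * signedArea (p a) (p j) (p b) = 0 ∧
      ∀ i, a < i → i < b →
        circlePower α β γ (p i) + τ * signedArea (p a) (p i) (p b) ≤ 0 := by
  -- Each interior vertex bounds τ from above; the least bound is attained at the vertex that the
  -- circle meets.
  obtain ⟨j, hj, hmin⟩ := (Finset.Ioo a b).exists_min_image
    (fun i => -circlePower α β γ (p i) / signedArea (p a) (p i) (p b))
    ⟨a + 1, Finset.mem_Ioo.2 ⟨by omega, by omega⟩⟩
  rw [Finset.mem_Ioo] at hj
  refine ⟨-circlePower α β γ (p j) / signedArea (p a) (p j) (p b), j, hj.1, hj.2, ?_, ?_⟩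
  · have := (H j hj.1 hj.2).ne'
    field_simp
    ring
  · intro i hi hib
    have h1 := hmin i (Finset.mem_Ioo.2 ⟨hi, hib⟩)
    rw [le_div_iff₀ (H i hi hib)] at h1
    linarith

/-- Shrink the enclosing circle, keeping it through `p a` and `p b`, until it meets a vertex between
them; then pass to a shorter subchain. Here `d` bounds the length of the subchain. -/
theorem exists_ear_circle_of_circle {p : ℕ → EuclideanSpace ℝ (Fin 2)} {o M : ℕ}
    (H : ∀ a b c, o ≤ a → a < b → b < c → c ≤ M → 0 < signedArea (p a) (p b) (p c))
    (d : ℕ) : ∀ (a b : ℕ) (α β γ : ℝ), b - a ≤ d → o ≤ a → a + 2 ≤ b → b ≤ M →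
      circlePower α β γ (p a) = 0 → circlePower α β γ (p b) = 0 →
      (∀ w, o ≤ w → w ≤ M → circlePower α β γ (p w) ≤ 0) →
      ∃ u, o ≤ u ∧ u + 2 ≤ M ∧ ∃ α β γ : ℝ, circlePower α β γ (p u) = 0 ∧
        circlePower α β γ (p (u + 1)) = 0 ∧ circlePower α β γ (p (u + 2)) = 0 ∧
        ∀ w, o ≤ w → w ≤ M → circlePower α β γ (p w) ≤ 0 := by
  induction d with
  | zero => intros; omega
  | succ d ih =>
    intro a b α β γ hd ha hab hb hpa hpb hneg
    obtain ⟨τ, j, haj, hjb, hj0, hle⟩ := exists_pencil_apex hab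
      (fun j h1 h2 => H a j b ha h1 h2 hb) α β γ
    -- With this sign, the powers of the vertices beyond the chord `a b`, where the area is
    -- negative, can only decrease.
    have hτ : 0 ≤ τ := by
      have h1 := hneg j (by omega) (by omega)
      have h2 := H a j b ha haj hjb hb
      by_contra! h3
      have := mul_neg_of_neg_of_pos h3 h2
      linarith
    obtain ⟨α', β', γ', h'⟩ := exists_circlePower_add_mul_signedArea α β γ τ (p a) (p b)
    have h'a : circlePower α' β' γ' (p a) = 0 := by
      rw [h', hpa, signedArea_self_left]; ring
    have h'b : circlePower α' β' γ' (p b) = 0 := by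
      rw [h', hpb, signedArea_self_right]; ring
    have h'j : circlePower α' β' γ' (p j) = 0 := by rw [h', hj0]
    have h'neg : ∀ w, o ≤ w → w ≤ M → circlePower α' β' γ' (p w) ≤ 0 := by
      intro w how hwM
      rcases lt_trichotomy w a with h1 | rfl | h1
      · have h2 := H w a b how h1 (by omega) hb
        have h3 := hneg w how hwM
        have h4 : signedArea (p a) (p w) (p b) = -signedArea (p w) (p a) (p b) := by
          simp only [signedArea]; ring
        rw [h', h4]
        have := mul_nonneg hτ h2.le
        linarith
      · exact h'a.le
      · rcases lt_trichotomy w b with h2 | rfl | h2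
        · rw [h']; exact hle w h1 h2
        · exact h'b.le
        · have h2 := H a b w ha (by omega) h2 hwM
          have h3 := hneg w how hwM
          have h4 : signedArea (p a) (p w) (p b) = -signedArea (p a) (p b) (p w) := by
            simp only [signedArea]; ring
          rw [h', h4]
          have := mul_nonneg hτ h2.le
          linarith
    by_cases h1 : a + 2 ≤ j
    · exact ih a j α' β' γ' (by omega) ha h1 (by omega) h'a h'j h'neg
    by_cases h2 : j + 2 ≤ b
    · exact ih j b α' β' γ' (by omega) (by omega) h2 hb h'j h'b h'neg
    obtain rfl : j = a + 1 := by omega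
    obtain rfl : b = a + 2 := by omega
    exact ⟨a, ha, hb, α', β', γ', h'a, h'j, h'b, h'neg⟩

theorem exists_ear_circle {p : ℕ → EuclideanSpace ℝ (Fin 2)} {o M : ℕ} (hoM : o + 2 ≤ M)
    (H : ∀ a b c, o ≤ a → a < b → b < c → c ≤ M → 0 < signedArea (p a) (p b) (p c)) :
    ∃ u, o ≤ u ∧ u + 2 ≤ M ∧ ∃ α β γ : ℝ, circlePower α β γ (p u) = 0 ∧
      circlePower α β γ (p (u + 1)) = 0 ∧ circlePower α β γ (p (u + 2)) = 0 ∧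
      ∀ w, o ≤ w → w ≤ M → circlePower α β γ (p w) ≤ 0 := by
  -- No vertex lies beyond the chord `o M`, so the sign of τ is irrelevant here.
  obtain ⟨α₀, β₀, γ₀, h₀⟩ := exists_circlePower_eq_dotAt (p o) (p M)
  obtain ⟨τ, j, -, -, -, hle⟩ := exists_pencil_apex hoM
    (fun j h1 h2 => H o j M le_rfl h1 h2 le_rfl) α₀ β₀ γ₀
  obtain ⟨α, β, γ, h⟩ := exists_circlePower_add_mul_signedArea α₀ β₀ γ₀ τ (p o) (p M)
  have ho : circlePower α β γ (p o) = 0 := by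
    rw [h, h₀]; simp only [dotAt, signedArea]; ring
  have hM : circlePower α β γ (p M) = 0 := by
    rw [h, h₀]; simp only [dotAt, signedArea]; ring
  refine exists_ear_circle_of_circle H (M - o) o M α β γ le_rfl le_rfl hoM le_rfl ho hM ?_
  intro w how hwM
  rcases how.eq_or_lt with rfl | h1
  · exact ho.le
  rcases hwM.eq_or_lt with rfl | h2
  · exact hM.le
  rw [h]; exact hle w h1 h2

variable {n : ℕ}

/-! ### Unrolled positions -/

/-- The vertex reached from vertex `0` by `m` counter-clockwise steps. -/
def idx (hn : 0 < n) (m : ℕ) : Fin n := ⟨m % n, Nat.mod_lt m hn⟩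

theorem idx_add_self (hn : 0 < n) (m : ℕ) : idx hn (m + n) = idx hn m := by
  simp [idx]

/-- Positions from `n` on leave room to walk back almost one turn without truncated subtraction. -/
theorem exists_idx_eq (hn : 0 < n) (v : Fin n) : ∃ m, n ≤ m ∧ m < 2 * n ∧ idx hn m = v :=
  ⟨v + n, by omega, by omega, by
    rw [idx_add_self]
    exact Fin.ext (Nat.mod_eq_of_lt v.2)⟩

theorem exists_mod_eq (hn : 0 < n) {a b : ℕ} (hab : a ≤ b) (hb : b < a + n) :
    ∃ r q, r < n ∧ a = r + n * q ∧ a % n = r ∧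
      b % n = (if r + (b - a) < n then r + (b - a) else r + (b - a) - n) := by
  refine ⟨a % n, a / n, Nat.mod_lt _ hn, (Nat.mod_add_div a n).symm, rfl, ?_⟩
  have hr := Nat.mod_lt a hn
  have hb' : b = a % n + (b - a) + n * (a / n) := by
    have := Nat.mod_add_div a n
    omega
  conv_lhs => rw [hb']
  rw [Nat.add_mul_mod_self_left]
  split_ifs with h
  · exact Nat.mod_eq_of_lt h
  · rw [Nat.mod_eq_sub_mod (by omega), Nat.mod_eq_of_lt (by omega)]

theorem steps_idx (hn : 0 < n) {a b : ℕ} (hab : a ≤ b) (hb : b < a + n) :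
    steps (idx hn a) (idx hn b) = b - a := by
  obtain ⟨r, q, hr, -, har, hbr⟩ := exists_mod_eq hn hab hb
  simp only [steps, idx, Fin.sub_def, har, hbr]
  split_ifs with h
  · rw [show n - r + (r + (b - a)) = b - a + n by omega, Nat.add_mod_right,
      Nat.mod_eq_of_lt (by omega)]
  · rw [show n - r + (r + (b - a) - n) = b - a by omega, Nat.mod_eq_of_lt (by omega)]

theorem idx_injOn (hn : 0 < n) {a b : ℕ} (hab : a ≤ b) (hb : b < a + n)
    (h : idx hn a = idx hn b) : a = b := by
  have h1 := steps_idx hn hab hb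
  have h2 := steps_idx hn le_rfl (show a < a + n by omega)
  rw [← h, h2] at h1
  omega

theorem exists_idx_eq_ge (hn : 0 < n) (x : ℕ) (v : Fin n) :
    ∃ d, d < n ∧ idx hn (x + d) = v := by
  have hinj : Function.Injective (fun d : Fin n => idx hn (x + d)) := by
    intro d e hde
    rcases le_total (d : ℕ) e with h | h
    · have := idx_injOn hn (by omega) (by omega) hde
      exact Fin.ext (by omega)
    · have := idx_injOn hn (by omega) (by omega) hde.symm
      exact Fin.ext (by omega)
  obtain ⟨d, hd⟩ := (Finite.injective_iff_surjective.1 hinj) v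
  exact ⟨d, d.2, hd⟩

theorem signedArea_idx_pos (P : ConvexNGon n) (hn : 0 < n) {a b c : ℕ} (hab : a < b)
    (hbc : b < c) (hca : c < a + n) :
    0 < signedArea (P.vertex (idx hn a)) (P.vertex (idx hn b)) (P.vertex (idx hn c)) := by
  obtain ⟨r, q, hr, -, har, hbr⟩ := exists_mod_eq hn hab.le (hbc.trans hca)
  obtain ⟨r', q', hr', -, har', hcr⟩ := exists_mod_eq hn (hab.trans hbc).le hca
  obtain rfl : r = r' := har.symm.trans har'
  by_cases h1 : r + (c - a) < n
  · rw [if_pos h1] at hcr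
    rw [if_pos (by omega)] at hbr
    exact P.ccw _ _ _ (by simp only [idx, Fin.mk_lt_mk]; omega)
      (by simp only [idx, Fin.mk_lt_mk]; omega)
  rw [if_neg h1] at hcr
  by_cases h2 : r + (b - a) < n
  · rw [if_pos h2] at hbr
    rw [← signedArea_rotate, ← signedArea_rotate]
    exact P.ccw _ _ _ (by simp only [idx, Fin.mk_lt_mk]; omega)
      (by simp only [idx, Fin.mk_lt_mk]; omega)
  · rw [if_neg h2] at hbr
    rw [← signedArea_rotate]
    exact P.ccw _ _ _ (by simp only [idx, Fin.mk_lt_mk]; omega)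
      (by simp only [idx, Fin.mk_lt_mk]; omega)

theorem vertex_idx_ne (P : ConvexNGon n) (hn : 0 < n) {a b : ℕ} (hab : a < b) (hb : b < a + n) :
    P.vertex (idx hn a) ≠ P.vertex (idx hn b) := by
  intro h
  have h3 := P.three_le
  by_cases hb' : b + 1 < a + n
  · have := P.signedArea_idx_pos hn hab (Nat.lt_succ_self b) hb'
    rw [h, signedArea_self_left] at this
    exact lt_irrefl _ this
  · have := P.signedArea_idx_pos hn (Nat.lt_succ_self a) (show a + 1 < b by omega) hb
    rw [h, ← signedArea_rotate, signedArea_self_right] at this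
    exact lt_irrefl _ this

/-! ### Gaps of a subpolygon -/

/-- The positions `s` and `t` carry consecutive vertices of `Q`. -/
structure IsGap (hn : 0 < n) (Q : Finset (Fin n)) (s t : ℕ) : Prop where
  left_mem : idx hn s ∈ Q
  right_mem : idx hn t ∈ Q
  lt : s < t
  le_add : t ≤ s + n
  notMem : ∀ y, s < y → y < t → idx hn y ∉ Q

theorem exists_isGap (hn : 0 < n) {Q : Finset (Fin n)} (hQ : Q.Nonempty) {x : ℕ} (hx : n ≤ x)
    (hxQ : idx hn x ∉ Q) : ∃ s t, IsGap hn Q s t ∧ s < x ∧ x < t ∧ x < s + n := by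
  obtain ⟨q, hq⟩ := hQ
  have hup : ∃ t, x < t ∧ idx hn t ∈ Q := by
    obtain ⟨d, -, hd⟩ := exists_idx_eq_ge hn (x + 1) q
    exact ⟨x + 1 + d, by omega, hd ▸ hq⟩
  have hdown : ∃ e, 0 < e ∧ e < n ∧ idx hn (x - e) ∈ Q := by
    obtain ⟨d, hd, hdq⟩ := exists_idx_eq_ge hn (x - n) q
    rcases Nat.eq_zero_or_pos d with rfl | hd0
    · exact absurd hq (by
        rw [← hdq, Nat.add_zero, ← idx_add_self, Nat.sub_add_cancel hx]; exact hxQ)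
    · exact ⟨n - d, by omega, by omega, by
        rw [show x - (n - d) = x - n + d by omega, hdq]; exact hq⟩
  classical
  have hu := Nat.find_spec hup
  have hd := Nat.find_spec hdown
  have hmin := fun m (h : m < Nat.find hup) => Nat.find_min hup h
  have hmin' := fun m (h : m < Nat.find hdown) => Nat.find_min hdown h
  set t := Nat.find hup
  set e := Nat.find hdown
  refine ⟨x - e, t, ⟨hd.2.2, hu.2, by omega, ?_, ?_⟩, by omega, hu.1, by omega⟩
  -- One full turn after the left end is again a vertex of `Q`; equality `t = s + n` occurs when `Q`
  -- is a single point.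
  · by_contra! hlt
    exact hmin (x - e + n) hlt ⟨by omega, by rw [idx_add_self]; exact hd.2.2⟩
  · intro y hy hyt hyQ
    rcases lt_trichotomy x y with h | rfl | h
    · exact hmin y hyt ⟨h, hyQ⟩
    · exact hxQ hyQ
    · exact hmin' (x - y) (by omega) ⟨by omega, by omega, by
        rw [show x - (x - y) = y by omega]; exact hyQ⟩

theorem IsGap.next_eq {hn : 0 < n} {Q : Finset (Fin n)} {s t y : ℕ} (h : IsGap hn Q s t)
    (hQ : Q.Nonempty) (hsy : s < y) (hyt : y < t) : next Q hQ (idx hn y) = idx hn t := by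
  obtain ⟨hmem, hle⟩ := next_spec Q hQ (idx hn y)
  have h1 := hle _ h.right_mem
  have := h.le_add
  rw [steps_idx hn hyt.le (by omega)] at h1
  obtain ⟨d, hd, hdq⟩ := exists_idx_eq_ge hn y (next Q hQ (idx hn y))
  rw [← hdq, steps_idx hn (by omega) (by omega)] at h1
  rw [← hdq] at hmem ⊢
  rcases lt_or_ge (y + d) t with h2 | h2
  · exact absurd hmem (h.notMem _ (by omega) h2)
  · congr 1; omega

theorem IsGap.prev_eq {hn : 0 < n} {Q : Finset (Fin n)} {s t y : ℕ} (h : IsGap hn Q s t)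
    (hQ : Q.Nonempty) (hsy : s < y) (hyt : y < t) : prev Q hQ (idx hn y) = idx hn s := by
  obtain ⟨hmem, hle⟩ := prev_spec Q hQ (idx hn y)
  have h1 := hle _ h.left_mem
  have := h.le_add
  rw [steps_idx hn hsy.le (by omega)] at h1
  obtain ⟨d, hd, hdq⟩ := exists_idx_eq_ge hn (y + 1) (prev Q hQ (idx hn y))
  rw [← hdq, ← idx_add_self hn y, steps_idx hn (by omega) (by omega)] at h1
  rw [← hdq] at hmem ⊢
  rcases lt_or_ge (s + n) (y + 1 + d) with h2 | h2
  · refine absurd hmem ?_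
    rw [show y + 1 + d = (y + 1 + d - n) + n by omega, idx_add_self]
    exact h.notMem _ (by omega) (by omega)
  · rw [← idx_add_self hn s]
    congr 1; omega

theorem IsGap.vertexError_eq {hn : 0 < n} {Q : Finset (Fin n)} {s t y : ℕ}
    (h : IsGap hn Q s t) (P : ConvexNGon n) (hQ : Q.Nonempty) (hsy : s < y) (hyt : y < t) :
    P.vertexError Q hQ (idx hn y) = P.psi (idx hn y) (idx hn s) (idx hn t) := by
  rw [vertexError, if_neg (h.notMem y hsy hyt), h.next_eq hQ hsy hyt, h.prev_eq hQ hsy hyt]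

/-! ### Properties of the vertex error -/

theorem psi_nonneg (P : ConvexNGon n) (v s t : Fin n) : 0 ≤ P.psi v s t :=
  sub_nonneg.2 (EuclideanGeometry.angle_le_pi _ _ _)

theorem psi_le_pi (P : ConvexNGon n) (v s t : Fin n) : P.psi v s t ≤ Real.pi :=
  sub_le_self _ (EuclideanGeometry.angle_nonneg _ _ _)

theorem vertexError_nonneg (P : ConvexNGon n) (Q : Finset (Fin n)) (hQ : Q.Nonempty)
    (v : Fin n) : 0 ≤ P.vertexError Q hQ v := by
  unfold vertexError
  split_ifs
  exacts [le_rfl, P.psi_nonneg _ _ _]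

theorem vertexError_le_pi (P : ConvexNGon n) (Q : Finset (Fin n)) (hQ : Q.Nonempty)
    (v : Fin n) : P.vertexError Q hQ v ≤ Real.pi := by
  unfold vertexError
  split_ifs
  exacts [Real.pi_pos.le, P.psi_le_pi _ _ _]

theorem psi_idx_add_self (P : ConvexNGon n) (hn : 0 < n) {s y : ℕ} (hsy : s < y)
    (hy : y < s + n) : P.psi (idx hn y) (idx hn s) (idx hn (s + n)) = Real.pi := by
  rw [psi, idx_add_self, EuclideanGeometry.angle_self_of_ne (P.vertex_idx_ne hn hsy hy), sub_zero]

/-- The error of a vertex grows with the gap around it. -/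
theorem psi_mono (P : ConvexNGon n) (hn : 0 < n) {s a v b t : ℕ} (hsa : s ≤ a) (hav : a < v)
    (hvb : v < b) (hbt : b ≤ t) (hts : t ≤ s + n) :
    P.psi (idx hn v) (idx hn a) (idx hn b) ≤ P.psi (idx hn v) (idx hn s) (idx hn t) := by
  rcases hts.eq_or_lt with rfl | hts
  · rw [P.psi_idx_add_self hn (by omega) (by omega)]
    exact P.psi_le_pi _ _ _
  have hsvt := P.signedArea_idx_pos hn (show s < v by omega) (show v < t by omega) hts
  have havt := P.signedArea_idx_pos hn hav (show v < t by omega) (by omega)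
  have havb := P.signedArea_idx_pos hn hav hvb (by omega)
  refine (pi_sub_angle_mono_right havb havt ?_).trans (pi_sub_angle_mono_left havt hsvt ?_)
  · rcases hbt.eq_or_lt with rfl | h
    · rw [signedArea_self_right]
    · exact (P.signedArea_idx_pos hn hvb h (by omega)).le
  · rcases hsa.eq_or_lt with rfl | h
    · rw [signedArea_self_left]
    · exact (P.signedArea_idx_pos hn h hav (by omega)).le

/-- The exterior angle of `P` at a vertex. -/
noncomputable def exteriorAngle (P : ConvexNGon n) (v : Fin n) : ℝ :=
  P.psi v (idx v.pos (v + n - 1)) (idx v.pos (v + 1))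

theorem exteriorAngle_idx (P : ConvexNGon n) (hn : 0 < n) (x : ℕ) :
    P.exteriorAngle (idx hn (x + 1)) = P.psi (idx hn (x + 1)) (idx hn x) (idx hn (x + 2)) := by
  have h : ∀ a b, a % n = b % n → idx hn a = idx hn b := fun a b hab => Fin.ext hab
  have hm : (x + 1) % n ≡ x + 1 [MOD n] := Nat.mod_modEq _ _
  unfold exteriorAngle
  congr 1
  · refine h _ _ (Nat.ModEq.add_right_cancel' 1 ?_)
    simp only [idx]
    rw [show (x + 1) % n + n - 1 + 1 = (x + 1) % n + n by omega]
    exact (Nat.add_modEq_right.trans hm)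
  · exact h _ _ (hm.add_right 1)

theorem exteriorAngle_le_vertexError (P : ConvexNGon n) {Q : Finset (Fin n)} (hQ : Q.Nonempty)
    {v : Fin n} (hv : v ∉ Q) : P.exteriorAngle v ≤ P.vertexError Q hQ v := by
  have hn := v.pos
  obtain ⟨x, hx, -, rfl⟩ := exists_idx_eq hn v
  obtain ⟨s, t, hg, hs, ht, -⟩ := exists_isGap hn hQ hx hv
  obtain ⟨x, rfl⟩ : ∃ y, x = y + 1 := ⟨x - 1, by omega⟩
  rw [hg.vertexError_eq P hQ hs ht, P.exteriorAngle_idx]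
  exact P.psi_mono hn (by omega) (by omega) (by omega) (by omega) hg.le_add

/-- If the circle through three consecutive vertices `a`, `a + 1`, `a + 2` encloses `s` and `t`, then
in a longer gap from `s` to `t` a neighbour of `a + 1` has at least the error of `a + 1`. -/
theorem exists_psi_le (P : ConvexNGon n) (hn : 0 < n) {s a t : ℕ} {α β γ : ℝ}
    (ha : circlePower α β γ (P.vertex (idx hn a)) = 0)
    (hu : circlePower α β γ (P.vertex (idx hn (a + 1))) = 0)
    (hb : circlePower α β γ (P.vertex (idx hn (a + 2))) = 0)
    (hs : circlePower α β γ (P.vertex (idx hn s)) ≤ 0)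
    (ht : circlePower α β γ (P.vertex (idx hn t)) ≤ 0)
    (hsa : s ≤ a) (hbt : a + 2 ≤ t) (hts : t < s + n) (hne : s < a ∨ a + 2 < t) :
    ∃ w, s < w ∧ w < t ∧ w ≠ a + 1 ∧ w < a + 1 + n ∧ a + 1 < w + n ∧
      P.psi (idx hn (a + 1)) (idx hn s) (idx hn t) ≤ P.psi (idx hn w) (idx hn s) (idx hn t) := by
  have hsut := P.signedArea_idx_pos hn (show s < a + 1 by omega) (show a + 1 < t by omega) hts
  have haub := P.signedArea_idx_pos hn (Nat.lt_succ_self a) (Nat.lt_succ_self (a + 1)) (by omega)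
  obtain ⟨α', β', γ', h's, h'u, h't, hle⟩ := exists_circlePower_pencil hsut
  have hleft : s < a → 0 ≤ circlePower α' β' γ' (P.vertex (idx hn a)) →
      ∃ w, s < w ∧ w < t ∧ w ≠ a + 1 ∧ w < a + 1 + n ∧ a + 1 < w + n ∧
      P.psi (idx hn (a + 1)) (idx hn s) (idx hn t) ≤ P.psi (idx hn w) (idx hn s) (idx hn t) :=
    fun h1 h2 => ⟨a, h1, by omega, by omega, by omega, by omega,
      hle _ (P.signedArea_idx_pos hn h1 (by omega) hts) h2⟩
  have hright : a + 2 < t → 0 ≤ circlePower α' β' γ' (P.vertex (idx hn (a + 2))) →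
      ∃ w, s < w ∧ w < t ∧ w ≠ a + 1 ∧ w < a + 1 + n ∧ a + 1 < w + n ∧
      P.psi (idx hn (a + 1)) (idx hn s) (idx hn t) ≤ P.psi (idx hn w) (idx hn s) (idx hn t) :=
    fun h1 h2 => ⟨a + 2, by omega, h1, by omega, by omega, by omega,
      hle _ (P.signedArea_idx_pos hn (by omega) h1 hts) h2⟩
  rcases hsa.eq_or_lt with rfl | hsa
  · have e := signedArea_mul_circlePower_sub ha hu hb h'u (P.vertex (idx hn t))
    rw [h't, h's] at e
    have h3 := P.signedArea_idx_pos hn (Nat.lt_succ_self s) (show s + 1 < t by omega) hts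
    refine hright (by omega) (nonneg_of_mul_nonneg_right ?_ h3)
    have := mul_nonpos_of_nonneg_of_nonpos haub.le ht
    linarith
  -- A positive combination of the powers of both neighbours with respect to the circle through `s`,
  -- `u`, `t` is nonnegative, so one of the two powers is.
  · have e := signedArea_mul_circlePower_sub ha hu hb h'u (P.vertex (idx hn s))
    rw [h's] at e
    have h1 := P.signedArea_idx_pos hn (show s < a + 1 by omega) (Nat.lt_succ_self (a + 1))
      (by omega)
    have h2 := P.signedArea_idx_pos hn hsa (Nat.lt_succ_self a) (by omega)
    rw [← signedArea_rotate] at h2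
    have h4 := mul_nonpos_of_nonneg_of_nonpos haub.le hs
    rcases hbt.eq_or_lt with rfl | hbt
    · rw [h't] at e
      refine hleft hsa (nonneg_of_mul_nonneg_right ?_ h1)
      linarith
    · by_cases h5 : 0 ≤ circlePower α' β' γ' (P.vertex (idx hn a))
      · exact hleft hsa h5
      · refine hright hbt (nonneg_of_mul_nonneg_right ?_ h2)
        have := mul_neg_of_pos_of_neg h1 (not_le.1 h5)
        linarith

/-! ### Worst-approximable polygons -/

theorem WorstApproximable.exists_error_lt {P : ConvexNGon n} {k : ℕ} (hk : 0 < k)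
    (hP : P.WorstApproximable k) {R : Finset (Fin n)} (hR : R.Nonempty) (hR' : R ≠ Finset.univ) :
    ∃ (Q : Finset (Fin n)) (hQ : Q.Nonempty), Q ⊆ R ∧ Q.card ≤ k ∧
      ∀ v ∈ R, P.vertexError Q hQ v < P.optimalError k Finset.univ := by
  obtain ⟨Q, hQ, hQR, hcard, he⟩ := (P.isLeast_optimalError hk hR).1
  refine ⟨Q, hQ, hQR, hcard, fun v hv => ?_⟩
  have h := hP R hR hR'
  rw [← he] at h
  exact (Finset.le_sup' (P.vertexError Q hQ) hv).trans_lt h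

theorem exists_optimalError_le_vertexError (P : ConvexNGon n) {k : ℕ} (hk : 0 < k)
    (Q : Finset (Fin n)) (hQ : Q.Nonempty) (hcard : Q.card ≤ k) :
    ∃ v, P.optimalError k Finset.univ ≤ P.vertexError Q hQ v := by
  have h := (P.isLeast_optimalError hk (hQ.mono (Finset.subset_univ Q))).2
    ⟨Q, hQ, Finset.subset_univ Q, hcard, rfl⟩
  obtain ⟨v, -, hv⟩ := (Finset.le_sup'_iff _).1 h
  exact ⟨v, hv⟩

theorem WorstApproximable.lt_card {P : ConvexNGon n} {k : ℕ} (hk : 0 < k)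
    (hP : P.WorstApproximable k) : k < n := by
  by_contra! hle
  have h3 := P.three_le
  let o : Fin n := ⟨0, by omega⟩
  have hne : ({o} : Finset (Fin n)) ≠ Finset.univ := by
    intro h
    have := congrArg Finset.card h
    simp at this
    omega
  obtain ⟨Q, hQ, -, -, hlt⟩ := hP.exists_error_lt hk (Finset.singleton_nonempty o) hne
  obtain ⟨v, hv⟩ := P.exists_optimalError_le_vertexError hk Finset.univ ⟨o, Finset.mem_univ o⟩
    (by simpa using hle)
  have h0 : P.vertexError Finset.univ ⟨o, Finset.mem_univ o⟩ v = 0 := if_pos (Finset.mem_univ v)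
  have h1 := hlt o (Finset.mem_singleton_self o)
  have h2 := P.vertexError_nonneg Q hQ o
  linarith

/-- A subpolygon all of whose vertices have a large exterior angle in `P` is hard to approximate. -/
theorem WorstApproximable.card_le_of_le_exteriorAngle {P : ConvexNGon n} {k : ℕ} (hk : 0 < k)
    (hP : P.WorstApproximable k) (hn : k + 1 < n) {L : Finset (Fin n)}
    (hL : ∀ v ∈ L, P.optimalError k Finset.univ ≤ P.exteriorAngle v) : L.card ≤ k := by
  by_contra! hlt
  obtain ⟨R, hRL, hR⟩ := Finset.exists_subset_card_eq (Nat.succ_le_of_lt hlt)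
  have hne : R ≠ Finset.univ := by
    rintro rfl
    simp at hR
    omega
  obtain ⟨Q, hQ, -, hcard, hQlt⟩ :=
    hP.exists_error_lt hk (Finset.card_pos.1 (by omega)) hne
  obtain ⟨v, hvR, hvQ⟩ := Finset.exists_mem_notMem_of_card_lt_card (show Q.card < R.card by omega)
  exact absurd ((hL v (hRL hvR)).trans (P.exteriorAngle_le_vertexError hQ hvQ))
    (not_le.2 (hQlt v hvR))

/-- A maximal chain of vertices outside `L`, in unrolled positions. -/
theorem exists_chain (hn : 3 ≤ n) (L : Finset (Fin n)) (hL : L ≠ Finset.univ) :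
    ∃ o M, n ≤ o ∧ o + 2 ≤ M ∧ M < o + n ∧
      (∀ x, o < x → x < M → idx (by omega : 0 < n) x ∉ L) ∧
      (M + 1 = o + n ∨ idx (by omega : 0 < n) o ∈ L ∧ idx (by omega : 0 < n) M ∈ L) := by
  have hn0 : 0 < n := by omega
  rcases L.eq_empty_or_nonempty with rfl | hne
  · exact ⟨n, n + (n - 1), le_rfl, by omega, by omega, by simp, Or.inl (by omega)⟩
  obtain ⟨u, hu⟩ : ∃ u, u ∉ L := by
    by_contra! h
    exact hL (Finset.eq_univ_iff_forall.2 h)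
  obtain ⟨x, hx, -, rfl⟩ := exists_idx_eq hn0 u
  obtain ⟨s, t, hg, hs, ht, -⟩ :=
    exists_isGap hn0 hne (show n ≤ x + n by omega) (by rwa [idx_add_self])
  have hle := hg.le_add
  by_cases h : t = s + n
  -- `L` is a single vertex: the chain runs through all of `P`.
  · exact ⟨s, s + (n - 1), by omega, by omega, by omega,
      fun y hy hyt => hg.notMem y hy (by omega), Or.inl (by omega)⟩
  · exact ⟨s, t, by omega, by omega, by omega, hg.notMem, Or.inr ⟨hg.left_mem, hg.right_mem⟩⟩

/-- Some vertex with a small exterior angle can be removed without making any approximation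
easier. -/
theorem exists_removable (P : ConvexNGon n) {E : ℝ} (hE : E ≤ Real.pi)
    (hsmall : ∃ v, P.exteriorAngle v < E) :
    ∃ u, ∀ (Q : Finset (Fin n)) (hQ : Q.Nonempty),
      (∀ v, v ≠ u → P.vertexError Q hQ v < E) → P.vertexError Q hQ u < E := by
  classical
  have h3 := P.three_le
  have hn : 0 < n := by omega
  let L : Finset (Fin n) := Finset.univ.filter (fun v => E ≤ P.exteriorAngle v)
  have hmemL : ∀ v, v ∈ L ↔ E ≤ P.exteriorAngle v := fun v => by simp [L]
  obtain ⟨o, M, hno, hoM, hMn, hchain, hends⟩ := exists_chain h3 L (fun h => by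
    obtain ⟨v, hv⟩ := hsmall
    exact absurd ((hmemL v).1 (h ▸ Finset.mem_univ v)) (not_le.2 hv))
  obtain ⟨a, hoa, haM, α, β, γ, ha, hu, hb, hneg⟩ :=
    exists_ear_circle (p := fun m => P.vertex (idx hn m)) hoM
      (fun i j l hi hij hjl hl => P.signedArea_idx_pos hn hij hjl (by omega))
  refine ⟨idx hn (a + 1), fun Q hQ hlt => ?_⟩
  have huL : P.exteriorAngle (idx hn (a + 1)) < E := by
    rw [← not_le, ← hmemL]
    exact hchain _ (by omega) (by omega)
  -- A vertex of `L` missed by `Q` would have error at least `E`.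
  have hLQ : ∀ v ∈ L, v ∈ Q := by
    intro v hv
    by_contra hvQ
    have h1 := (hmemL v).1 hv
    have h2 := hlt v (by rintro rfl; linarith)
    exact absurd (h1.trans (P.exteriorAngle_le_vertexError hQ hvQ)) (not_le.2 h2)
  by_cases huQ : idx hn (a + 1) ∈ Q
  · have h0 : P.vertexError Q hQ (idx hn (a + 1)) = 0 := if_pos huQ
    obtain ⟨v, hv⟩ : ∃ v, v ≠ idx hn (a + 1) :=
      ⟨idx hn (a + 2), fun h => by
        have := idx_injOn hn (Nat.le_succ (a + 1)) (by omega) h.symm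
        omega⟩
    rw [h0]
    exact (P.vertexError_nonneg Q hQ v).trans_lt (hlt v hv)
  obtain ⟨s, t, hg, hsu, hut, hsn⟩ := exists_isGap hn hQ (show n ≤ a + 1 by omega) huQ
  have hle := hg.le_add
  have hgap : ∀ w, s < w → w < t → w ≠ a + 1 → w < a + 1 + n → a + 1 < w + n →
      P.psi (idx hn w) (idx hn s) (idx hn t) < E := by
    intro w hsw hwt hw h1 h2
    rw [← hg.vertexError_eq P hQ hsw hwt]
    refine hlt _ fun h => ?_
    rcases le_total w (a + 1) with h4 | h4
    · exact hw (idx_injOn hn h4 h2 h)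
    · exact hw (idx_injOn hn h4 h1 h.symm).symm
  rw [hg.vertexError_eq P hQ hsu hut]
  -- In a gap of a full turn every vertex has error π ≥ `E`, including one other than `u`.
  have hts : t < s + n := by
    by_contra! h
    obtain rfl : t = s + n := by omega
    obtain ⟨w, hsw, hwt, hw⟩ : ∃ w, s < w ∧ w < s + n ∧ w ≠ a + 1 := by
      by_cases h : s + 1 = a + 1
      · exact ⟨s + 2, by omega, by omega, by omega⟩
      · exact ⟨s + 1, by omega, by omega, h⟩
    have := hgap w hsw hwt hw (by omega) (by omega)
    rw [P.psi_idx_add_self hn hsw hwt] at this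
    linarith
  -- Either the chain contains every vertex, up to a shift by `n`, or its ends belong to `Q` and
  -- confine the gap to the chain.
  have hpow : ∀ y, y < a + 1 + n → a + 1 < y + n → (y = s ∨ y = t) →
      circlePower α β γ (P.vertex (idx hn y)) ≤ 0 := by
    intro y h1 h2 hy
    rcases hends with h | ⟨hoL, hML⟩
    · rcases lt_or_ge y o with h4 | h4
      · rw [← idx_add_self]
        exact hneg _ (by omega) (by omega)
      · rcases lt_or_ge M y with h5 | h5
        · rw [show y = y - n + n by omega, idx_add_self]
          exact hneg _ (by omega) (by omega)
        · exact hneg _ h4 h5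
    · have hos : o ≤ s := by
        by_contra! h
        exact hg.notMem o h (by omega) (hLQ _ hoL)
      have htM : t ≤ M := by
        by_contra! h
        exact hg.notMem M (by omega) h (hLQ _ hML)
      exact hneg _ (by omega) (by omega)
  by_cases hne : s < a ∨ a + 2 < t
  · obtain ⟨w, hsw, hwt, hw, h1, h2, hle'⟩ := P.exists_psi_le hn ha hu hb
      (hpow s (by omega) (by omega) (Or.inl rfl)) (hpow t (by omega) (by omega) (Or.inr rfl))
      (by omega) (by omega) hts hne
    exact hle'.trans_lt (hgap w hsw hwt hw h1 h2)
  · obtain rfl : s = a := by omega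
    obtain rfl : t = s + 2 := by omega
    rwa [P.exteriorAngle_idx] at huL

end ConvexNGon

/-! ### Contradiction by deleting a removable vertex -/

theorem mainTheorem2 (k n : ℕ) (hk : 2 < k) (P : ConvexNGon n) (hP : P.WorstApproximable k) :
    n = k + 1 := by
  classical
  have hk0 : 0 < k := by omega
  have hlt := hP.lt_card hk0
  by_contra hne
  have hn : k + 1 < n := by omega
  let o : Fin n := ⟨0, by omega⟩
  have hE : P.optimalError k Finset.univ ≤ Real.pi := by
    obtain ⟨v, hv⟩ := P.exists_optimalError_le_vertexError hk0 {o} (Finset.singleton_nonempty o)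
      (by rw [Finset.card_singleton]; omega)
    exact hv.trans (P.vertexError_le_pi _ _ v)
  obtain ⟨u, hu⟩ := P.exists_removable hE (by
    by_contra! h
    have := hP.card_le_of_le_exteriorAngle hk0 hn (L := Finset.univ) fun v _ => h v
    rw [Finset.card_univ, Fintype.card_fin] at this
    omega)
  have hcard : (Finset.univ.erase u).card = n - 1 := by
    rw [Finset.card_erase_of_mem (Finset.mem_univ u), Finset.card_univ, Fintype.card_fin]
  obtain ⟨Q, hQ, -, hQk, hQlt⟩ := hP.exists_error_lt hk0
    (R := Finset.univ.erase u) (Finset.card_pos.1 (by omega))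
    (fun h => Finset.notMem_erase u _ (h ▸ Finset.mem_univ u))
  have hlt' : ∀ v, v ≠ u → P.vertexError Q hQ v < P.optimalError k Finset.univ :=
    fun v hv => hQlt v (Finset.mem_erase.2 ⟨hv, Finset.mem_univ v⟩)
  obtain ⟨v, hv⟩ := P.exists_optimalError_le_vertexError hk0 Q hQ hQk
  by_cases hvu : v = u
  · exact absurd (hvu ▸ hu Q hQ hlt') (not_lt.2 hv)
  · exact absurd (hlt' v hvu) (not_lt.2 hv)
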